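/- Let $G$ be a finite connected plane multigraph (loops and multiple edges allowed) with vertex set $V(G)$ and edges $e_1,\dots,e_E$, each coloured $c$ ("chain") or $s$ ("sheaf"). **W-polynomial.** For a multigraph $H$ with edge colours $\lambda$ in a set $\Lambda$, $W(H)(t,z_1,z_2)\in\mathbb Z[t,z_1,z_2,x_\lambda,y_\lambda:\lambda\in\Lambda]$ is defined recursively: $W(H)=t^{n-1}$ if $H$ has $n\ge 1$ vertices and no edges; for an edge $e$ of colour $\lambda$, $W(H)=(x_\lambda+z_1y_\lambda)W(H/e)$ if $e$ is a bridge, $W(H)=(x_\lambda z_2+y_\lambda)W(H-e)$ if $e$ is a loop, and $W(H)=x_\lambda W(H/e)+y_\lambda W(H-e)$ otherwise; and $W(H_1\sqcup H_2)=t\,W(H_1)W(H_2)$. Here $H-e$ and $H/e$ denote deletion and contraction. **Wiring diagram.** A wiring diagram is a plane 4-valent graph (closed curves without vertices allowed) each of whose vertices ("twist sites") is labelled horizontal or vertical. The wiring diagram $W_G$ of $G$ is the medial graph of $G$: it has one site on each edge of $G$, and, in its checkerboard shading, its shaded regions correspond to the vertices of $G$ (if $G$ is a single vertex without edges, $W_G$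 is a single closed curve). The $i$-th site is horizontal if $e_i$ is coloured $c$ and vertical if $e_i$ is coloured $s$. For $\sigma\in\{0,1\}^E$ the state $(W_G)_\sigma$ is the collection of closed curves obtained by replacing each site by two disjoint arcs: at a horizontal site with $\sigma_i=0$ and at a vertical site with $\sigma_i=1$ the arcs connect the two shaded regions that meet at the site, and at a horizontal site with $\sigma_i=1$ and at a vertical site with $\sigma_i=0$ they separate them. **Twist bracket.** Let $K$ be a field, $A\in K$ with $A\ne 0$, $d=-A^{-2}-A^{2}\neq 0$, and $x_1,\dots,x_E\in K$ (for instance, indeterminates). The (Champanerkar–Kofman) twist bracket of $W_G$ is $$P(A,x_1,\dots,x_E)=\sum_{\sigma\in\{0,1\}^E}\Big(\prod_{i=1}^E (x_i-1)^{\sigma_i}d^{\,1-\sigma_i}\Big)\langle (W_G)_\sigma\rangle ,$$ where the Kauffman bracket of a collection of $n$ disjoint closed curves is $d^{\,n-1}$. **Theorem.** Let $\tilde G$ be the graph $G$ with the edge $e_i$ recoloured by $c_i$ if it was coloured $c$ and by $s_i$ if it was coloured $s$. Then, under the evaluation $$x_{c_i}=1,\qquad y_{c_i}=\frac{x_i-1}{d},\qquad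 x_{s_i}=\frac{x_i-1}{d},\qquad y_{s_i}=1,$$ one has $$d^{E}\,W(\tilde G)(d,d,d)=P(A,x_1,\dots,x_E).$$ -/

import Mathlib

/-! ### Multigraphs: components, contraction, bridges -/

/-- The number of connected components of a multigraph. -/
noncomputable def Graph.componentCount {α β : Type*} (G : Graph α β) : ℕ :=
  Nat.card (Quot fun u v : G.vertexSet => G.Adj u v)

open Classical in
/-- Contraction of an edge `e` with ends `u` and `v`: the edge `e` is removed and its two ends are
identified (the resulting vertex keeps the name `u`). -/
noncomputable def Graph.contractEdge {α β : Type*} (G : Graph α β) (e : β) (u v : α) :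
    Graph α β :=
  (G.deleteEdges {e}).map (Function.update id v u)

/-- An edge is a bridge if deleting it increases the number of connected components. -/
def Graph.IsBridge {α β : Type*} (G : Graph α β) (e : β) : Prop :=
  e ∈ G.edgeSet ∧ G.componentCount < (G.deleteEdges {e}).componentCount

/-! ### The W-polynomial of a multigraph whose edges are coloured by `Λ` -/

/-- The variables of the W-polynomial: `t`, `z₁`, `z₂`, and `x_l`, `y_l` for every colour `l`. -/
inductive WVar (Λ : Type*) where
  | t : WVar Λ
  | z₁ : WVar Λ
  | z₂ : WVar Λ
  | x : Λ → WVar Λ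
  | y : Λ → WVar Λ

open MvPolynomial in
/-- The recursive definition of the W-polynomial, as a relation: `IsWPolynomial c G p` means that
the rules give the value `p` for the multigraph `G` with the edge colouring `c`. -/
inductive IsWPolynomial {α β Λ : Type*} (c : β → Λ) :
    Graph α β → MvPolynomial (WVar Λ) ℤ → Prop
  | edgeless (G : Graph α β) (hE : G.edgeSet = ∅) (hfin : G.vertexSet.Finite)
      (hne : G.vertexSet.Nonempty) :
      IsWPolynomial c G (X .t ^ (G.vertexSet.ncard - 1))
  | bridge (G : Graph α β) (e : β) (u v : α) (p : MvPolynomial (WVar Λ) ℤ)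
      (he : G.IsLink e u v) (hb : G.IsBridge e)
      (hp : IsWPolynomial c (G.contractEdge e u v) p) :
      IsWPolynomial c G ((X (.x (c e)) + X .z₁ * X (.y (c e))) * p)
  | loop (G : Graph α β) (e : β) (u : α) (p : MvPolynomial (WVar Λ) ℤ)
      (he : G.IsLoopAt e u)
      (hp : IsWPolynomial c (G.deleteEdges {e}) p) :
      IsWPolynomial c G ((X (.x (c e)) * X .z₂ + X (.y (c e))) * p)
  | ordinary (G : Graph α β) (e : β) (u v : α) (p q : MvPolynomial (WVar Λ) ℤ)
      (he : G.IsLink e u v) (huv : u ≠ v) (hb : ¬ G.IsBridge e)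
      (hp : IsWPolynomial c (G.contractEdge e u v) p)
      (hq : IsWPolynomial c (G.deleteEdges {e}) q) :
      IsWPolynomial c G (X (.x (c e)) * p + X (.y (c e)) * q)
  | disjointUnion (G G₁ G₂ : Graph α β) (p q : MvPolynomial (WVar Λ) ℤ)
      (hdisj : Disjoint G₁.vertexSet G₂.vertexSet)
      (hV : G.vertexSet = G₁.vertexSet ∪ G₂.vertexSet)
      (hlink : ∀ e u v, G.IsLink e u v ↔ G₁.IsLink e u v ∨ G₂.IsLink e u v)
      (hp : IsWPolynomial c G₁ p) (hq : IsWPolynomial c G₂ q) :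
      IsWPolynomial c G (X .t * p * q)

/-! #### The recursion determines a unique polynomial -/

namespace WPolynomialAux

/-- Identifying two points that were not related lowers the number of classes by one. -/
theorem card_quot_add_edge {X : Type*} [Finite X] {r r' : X → X → Prop} {u v : X}
    (h : ∀ a b, r' a b ↔ r a b ∨ (a = u ∧ b = v) ∨ (a = v ∧ b = u)) :
    (Quot.mk r u = Quot.mk r v → Nat.card (Quot r') = Nat.card (Quot r)) ∧
    (Quot.mk r u ≠ Quot.mk r v → Nat.card (Quot r') + 1 = Nat.card (Quot r)) := by
  classical
  have huv : Quot.mk r' u = Quot.mk r' v := Quot.sound ((h u v).2 (Or.inr (Or.inl ⟨rfl, rfl⟩)))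
  let g : Quot r → Quot r' :=
    Quot.lift (Quot.mk r') fun a b hab => Quot.sound ((h a b).2 (Or.inl hab))
  constructor
  · intro heq
    refine Nat.card_congr ⟨Quot.lift (Quot.mk r) ?_, g, ?_, ?_⟩
    · intro a b hab
      rcases (h a b).1 hab with hab | ⟨rfl, rfl⟩ | ⟨rfl, rfl⟩
      · exact Quot.sound hab
      · exact heq
      · exact heq.symm
    · rintro ⟨a⟩; rfl
    · rintro ⟨a⟩; rfl
  · intro hne
    let f : X → {q : Quot r // q ≠ Quot.mk r v} := fun a =>
      if ha : Quot.mk r a = Quot.mk r v then ⟨Quot.mk r u, hne⟩ else ⟨Quot.mk r a, ha⟩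
    have hf : ∀ a b, r' a b → f a = f b := by
      intro a b hab
      rcases (h a b).1 hab with hab | ⟨rfl, rfl⟩ | ⟨rfl, rfl⟩
      · have : Quot.mk r a = Quot.mk r b := Quot.sound hab
        simp only [f, this]
      · simp [f, hne]
      · simp [f, hne]
    have e : Quot r' ≃ {q : Quot r // q ≠ Quot.mk r v} := by
      refine ⟨Quot.lift f hf, fun q => g q.1, ?_, ?_⟩
      · rintro ⟨a⟩
        change g (f a).1 = Quot.mk r' a
        by_cases ha : Quot.mk r a = Quot.mk r v
        · simp only [f, ha, dite_true]
          have h1 : g (Quot.mk r a) = g (Quot.mk r v) := congrArg g ha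
          exact huv.trans h1.symm
        · simp only [f, ha, dite_false]; rfl
      · rintro ⟨⟨a⟩, ha⟩
        change f a = _
        have ha' : ¬ Quot.mk r a = Quot.mk r v := ha
        simp only [f, ha', dite_false]
    rw [Nat.card_congr e]
    have := Nat.card_congr (Equiv.sumCompl fun q : Quot r => q = Quot.mk r v)
    rw [Nat.card_sum, Nat.card_unique] at this
    rw [← this, add_comm]

variable {α β Λ : Type*}

theorem componentCount_add_edge [Finite α] {K K' : Graph α β} {u v : α}
    (hV : K'.vertexSet = K.vertexSet) (hu : u ∈ K.vertexSet) (hv : v ∈ K.vertexSet)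
    (h : ∀ a b, K'.Adj a b ↔ K.Adj a b ∨ (a = u ∧ b = v) ∨ (a = v ∧ b = u)) :
    ((Quot.mk (fun a b : K.vertexSet => K.Adj a b) ⟨u, hu⟩ = Quot.mk _ ⟨v, hv⟩) →
        K'.componentCount = K.componentCount) ∧
    ((Quot.mk (fun a b : K.vertexSet => K.Adj a b) ⟨u, hu⟩ ≠ Quot.mk _ ⟨v, hv⟩) →
        K'.componentCount + 1 = K.componentCount) := by
  have key := card_quot_add_edge (X := K.vertexSet) (r := fun a b => K.Adj a b)
    (r' := fun a b => K'.Adj a b) (u := ⟨u, hu⟩) (v := ⟨v, hv⟩)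
    (by rintro ⟨a, ha⟩ ⟨b, hb⟩; simpa using h a b)
  have hc : K'.componentCount = Nat.card (Quot fun a b : K.vertexSet => K'.Adj a b) := by
    unfold Graph.componentCount; rw [hV]
  rw [hc]; exact key

theorem adj_iff_of_link {H : Graph α β} {e : β} {u v : α} (he : H.IsLink e u v) (a b : α) :
    H.Adj a b ↔ (H.deleteEdges {e}).Adj a b ∨ (a = u ∧ b = v) ∨ (a = v ∧ b = u) := by
  constructor
  · rintro ⟨f, hf⟩
    by_cases hfe : f = e
    · subst hfe
      right
      rcases H.eq_or_eq_of_isLink_of_isLink hf he with h1 | h1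
      · left; subst h1; exact ⟨rfl, Graph.IsLink.right_unique hf he⟩
      · right; subst h1; exact ⟨rfl, Graph.IsLink.right_unique hf he.symm⟩
    · left; exact ⟨f, by simp [hf, hfe]⟩
  · rintro (⟨f, hf⟩ | ⟨rfl, rfl⟩ | ⟨rfl, rfl⟩)
    · exact ⟨f, by simp at hf; exact hf.1⟩
    · exact ⟨e, he⟩
    · exact ⟨e, he.symm⟩

theorem componentCount_contract {H : Graph α β} {e : β} {u v : α} (he : H.IsLink e u v) :
    (H.contractEdge e u v).componentCount = H.componentCount := by
  classical
  set f : α → α := Function.update id v u with hfdef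
  have fv : f v = u := by simp [f]
  have fo : ∀ a, a ≠ v → f a = a := fun a ha => by simp [f, ha]
  have hadj : ∀ a b, (H.contractEdge e u v).Adj a b ↔
      ∃ a' b', (H.deleteEdges {e}).Adj a' b' ∧ f a' = a ∧ f b' = b := by
    intro a b; simp only [Graph.contractEdge, Graph.map_adj, Relation.Map]; rfl
  have hmem : ∀ a ∈ H.vertexSet, f a ∈ (H.contractEdge e u v).vertexSet := by
    intro a ha; exact ⟨a, ha, rfl⟩
  have hsub : ∀ a ∈ (H.contractEdge e u v).vertexSet, a ∈ H.vertexSet := by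
    rintro _ ⟨a, ha, rfl⟩
    by_cases hav : a = v
    · change f a ∈ _; rw [hav, fv]; exact he.left_mem
    · change f a ∈ _; rw [fo a hav]; exact ha
  have hclass : ∀ (a : α) (ha : a ∈ H.vertexSet) (hfa : f a ∈ H.vertexSet),
      Quot.mk (fun a b : H.vertexSet => H.Adj a b) ⟨f a, hfa⟩ = Quot.mk _ ⟨a, ha⟩ := by
    intro a ha hfa
    by_cases hav : a = v
    · subst hav
      refine Quot.sound ?_
      change H.Adj (f a) a
      rw [fv]; exact ⟨e, he⟩
    · congr 2; exact fo a hav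
  have hfix : ∀ a ∈ (H.contractEdge e u v).vertexSet, f a = a := by
    rintro _ ⟨a, ha, rfl⟩
    change f (f a) = f a
    by_cases hav : a = v
    · rw [hav, fv]
      by_cases huv : u = v
      · rw [huv, fv, huv]
      · exact fo u huv
    · rw [fo a hav, fo a hav]
  refine Nat.card_congr ⟨Quot.lift (fun a => Quot.mk _ ⟨a.1, hsub _ a.2⟩) ?_,
    Quot.lift (fun a => Quot.mk _ ⟨f a.1, hmem _ a.2⟩) ?_, ?_, ?_⟩
  · rintro ⟨a, ha⟩ ⟨b, hb⟩ hab
    obtain ⟨a', b', h', h1, h2⟩ := (hadj a b).1 hab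
    subst h1 h2
    have ha' : a' ∈ H.vertexSet := h'.left_mem
    have hb' : b' ∈ H.vertexSet := h'.symm.left_mem
    change Quot.mk _ _ = Quot.mk _ _
    rw [hclass a' ha', hclass b' hb']
    refine Quot.sound ?_
    exact ((adj_iff_of_link he a' b').2 (Or.inl h'))
  · rintro ⟨a, ha⟩ ⟨b, hb⟩ hab
    have hfu : f u = u := by
      by_cases huv : u = v
      · rw [huv, fv, huv]
      · exact fo u huv
    rcases (adj_iff_of_link he a b).1 hab with hab | ⟨h1, h2⟩ | ⟨h1, h2⟩
    · exact Quot.sound ((hadj _ _).2 ⟨a, b, hab, rfl, rfl⟩)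
    · subst h1 h2; congr 2; rw [fv, hfu]
    · subst h1 h2; congr 2; rw [fv, hfu]
  · rintro ⟨⟨a, ha⟩⟩
    change Quot.mk _ _ = Quot.mk _ _
    congr 2
    exact hfix a ha
  · rintro ⟨⟨a, ha⟩⟩
    exact hclass a ha _

theorem ncard_contract [Finite α] {H : Graph α β} {e : β} {u v : α} (he : H.IsLink e u v)
    (huv : u ≠ v) : (H.contractEdge e u v).vertexSet.ncard + 1 = H.vertexSet.ncard := by
  classical
  have : (H.contractEdge e u v).vertexSet = H.vertexSet \ {v} := by
    ext a
    constructor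
    · rintro ⟨b, hb, rfl⟩
      by_cases hbv : b = v
      · subst hbv; simp [he.left_mem, huv]
      · rw [Function.update_of_ne hbv]; exact ⟨hb, hbv⟩
    · rintro ⟨ha, hav⟩
      exact ⟨a, ha, by rw [Function.update_of_ne hav]; rfl⟩
  rw [this]
  exact Set.ncard_sdiff_singleton_add_one he.right_mem (Set.toFinite _)

theorem restrict_insert_contract {H : Graph α β} {e : β} {u v : α} {S : Set β} (_heS : e ∉ S) :
    (H.restrict (insert e S)).contractEdge e u v = (H.contractEdge e u v).restrict S := by
  classical
  refine Graph.ext rfl ?_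
  intro f a b
  simp only [Graph.contractEdge, Graph.map_isLink, Graph.restrict_isLink,
    Graph.deleteEdges_isLink, Relation.Map, Set.mem_singleton_iff, Set.mem_insert_iff]
  constructor
  · rintro ⟨a', b', ⟨⟨h1, h2⟩, h3⟩, h4⟩
    exact ⟨h1.resolve_left h3, a', b', ⟨h2, h3⟩, h4⟩
  · rintro ⟨h1, a', b', ⟨h2, h3⟩, h4⟩
    exact ⟨a', b', ⟨⟨Or.inr h1, h2⟩, h3⟩, h4⟩

theorem restrict_insert_delete {H : Graph α β} {e : β} {S : Set β} (_heS : e ∉ S) :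
    (H.restrict (insert e S)).deleteEdges {e} = (H.deleteEdges {e}).restrict S := by
  refine Graph.ext rfl ?_
  intro f a b
  simp only [Graph.restrict_isLink, Graph.deleteEdges_isLink, Set.mem_singleton_iff,
    Set.mem_insert_iff]
  tauto

theorem restrict_delete {H : Graph α β} {e : β} {S : Set β} (heS : e ∉ S) :
    (H.deleteEdges {e}).restrict S = H.restrict S := by
  refine Graph.ext rfl ?_
  intro f a b
  simp only [Graph.restrict_isLink, Graph.deleteEdges_isLink, Set.mem_singleton_iff]
  constructor
  · rintro ⟨h1, h2, h3⟩; exact ⟨h1, h2⟩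
  · rintro ⟨h1, h2⟩; exact ⟨h1, h2, fun h => heS (h ▸ h1)⟩

theorem quot_mono {H K : Graph α β} (hV : H.vertexSet = K.vertexSet)
    (h : ∀ a b, H.Adj a b → K.Adj a b) {u v : α} (hu : u ∈ H.vertexSet) (hv : v ∈ H.vertexSet)
    (hq : Quot.mk (fun a b : H.vertexSet => H.Adj a b) ⟨u, hu⟩ = Quot.mk _ ⟨v, hv⟩) :
    Quot.mk (fun a b : K.vertexSet => K.Adj a b) ⟨u, hV ▸ hu⟩ = Quot.mk _ ⟨v, hV ▸ hv⟩ :=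
  congrArg (Quot.lift (fun a : H.vertexSet =>
    Quot.mk (fun a b : K.vertexSet => K.Adj a b) ⟨a.1, hV ▸ a.2⟩)
    (fun _ _ hab => Quot.sound (h _ _ hab))) hq

theorem componentCount_loop [Finite α] {H : Graph α β} {e : β} {u : α} (he : H.IsLink e u u) :
    (H.deleteEdges {e}).componentCount = H.componentCount :=
  ((componentCount_add_edge (K := H.deleteEdges {e}) (K' := H) rfl he.left_mem he.left_mem
    (adj_iff_of_link he)).1 rfl).symm

theorem componentCount_nonbridge [Finite α] {H : Graph α β} {e : β} {u v : α}
    (he : H.IsLink e u v) (hb : ¬ H.IsBridge e) :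
    (H.deleteEdges {e}).componentCount = H.componentCount := by
  have h := componentCount_add_edge (K := H.deleteEdges {e}) (K' := H) rfl he.left_mem he.right_mem
    (adj_iff_of_link he)
  by_cases hq : Quot.mk (fun a b : (H.deleteEdges {e}).vertexSet => (H.deleteEdges {e}).Adj a b)
      ⟨u, he.left_mem⟩ = Quot.mk _ ⟨v, he.right_mem⟩
  · exact (h.1 hq).symm
  · have := h.2 hq
    exact absurd ⟨he.edge_mem, by omega⟩ hb

theorem componentCount_bridge [Finite α] {H : Graph α β} {e : β} {u v : α}
    (he : H.IsLink e u v) (hb : H.IsBridge e) {S : Set β} (heS : e ∉ S) :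
    (H.restrict (insert e S)).componentCount + 1 = (H.restrict S).componentCount := by
  have h := componentCount_add_edge (K := H.deleteEdges {e}) (K' := H) rfl he.left_mem he.right_mem
    (adj_iff_of_link he)
  have he' : (H.restrict (insert e S)).IsLink e u v := by simp [he]
  have h' := componentCount_add_edge (K := H.restrict S)
    (K' := H.restrict (insert e S)) rfl he.left_mem he.right_mem (by
      have := adj_iff_of_link he'
      rwa [restrict_insert_delete heS, restrict_delete heS] at this)
  refine h'.2 fun hq => ?_
  have hq' := quot_mono (H := H.restrict S) (K := H.deleteEdges {e}) rfl (by
    rintro a b ⟨f, hf⟩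
    simp only [Graph.restrict_isLink] at hf
    refine ⟨f, ?_⟩
    simp only [Graph.deleteEdges_isLink, Set.mem_singleton_iff]
    exact ⟨hf.2, fun h => heS (h ▸ hf.1)⟩) _ _ hq
  have := h.1 hq'
  exact absurd hb.2 (by omega)

theorem componentCount_edgeless {H : Graph α β} (hE : H.edgeSet = ∅) :
    H.componentCount = H.vertexSet.ncard := by
  have hno : ∀ a b, ¬ H.Adj a b := by
    rintro a b ⟨e, he⟩
    have := he.edge_mem
    rw [hE] at this; exact this
  rw [← Nat.card_coe_set_eq]
  refine Nat.card_congr ⟨Quot.lift id fun a b h => absurd h (hno _ _), Quot.mk _, ?_, ?_⟩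
  · rintro ⟨a⟩; rfl
  · intro a; rfl

theorem componentCount_union [Finite α] {G G₁ G₂ : Graph α β}
    (hdisj : Disjoint G₁.vertexSet G₂.vertexSet)
    (hV : G.vertexSet = G₁.vertexSet ∪ G₂.vertexSet)
    (hadj : ∀ u v, G.Adj u v ↔ G₁.Adj u v ∨ G₂.Adj u v) :
    G.componentCount = G₁.componentCount + G₂.componentCount := by
  classical
  unfold Graph.componentCount
  rw [← Nat.card_sum]
  have hno1 : ∀ a b, G₁.Adj a b → a ∈ G₁.vertexSet ∧ b ∈ G₁.vertexSet :=
    fun a b h => ⟨h.left_mem, h.symm.left_mem⟩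
  have hno2 : ∀ a b, G₂.Adj a b → a ∉ G₁.vertexSet ∧ b ∉ G₁.vertexSet :=
    fun a b h => ⟨fun h' => Set.disjoint_left.1 hdisj h' h.left_mem,
      fun h' => Set.disjoint_left.1 hdisj h' h.symm.left_mem⟩
  have hm : ∀ a ∈ G.vertexSet, a ∉ G₁.vertexSet → a ∈ G₂.vertexSet := by
    intro a ha h; rw [hV] at ha; exact ha.resolve_left h
  let F : G.vertexSet → Quot (fun u v : G₁.vertexSet => G₁.Adj u v) ⊕
      Quot (fun u v : G₂.vertexSet => G₂.Adj u v) := fun a =>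
    if h : a.1 ∈ G₁.vertexSet then Sum.inl (Quot.mk _ ⟨a.1, h⟩)
    else Sum.inr (Quot.mk _ ⟨a.1, hm _ a.2 h⟩)
  refine Nat.card_congr ⟨Quot.lift F ?_, Sum.elim
    (Quot.lift (fun a => Quot.mk _ ⟨a.1, hV ▸ Or.inl a.2⟩) ?_)
    (Quot.lift (fun a => Quot.mk _ ⟨a.1, hV ▸ Or.inr a.2⟩) ?_), ?_, ?_⟩
  · rintro ⟨a, ha⟩ ⟨b, hb⟩ hab
    rcases (hadj a b).1 hab with h | h
    · have := hno1 _ _ h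
      simp only [F, this.1, this.2, dite_true]
      exact congrArg Sum.inl (Quot.sound h)
    · have := hno2 _ _ h
      simp only [F, this.1, this.2, dite_false]
      exact congrArg Sum.inr (Quot.sound h)
  · intro a b h; exact Quot.sound ((hadj _ _).2 (Or.inl h))
  · intro a b h; exact Quot.sound ((hadj _ _).2 (Or.inr h))
  · rintro ⟨⟨a, ha⟩⟩
    change Sum.elim _ _ (F ⟨a, ha⟩) = _
    by_cases h : a ∈ G₁.vertexSet
    · simp only [F, h, dite_true]; rfl
    · simp only [F, h, dite_false]; rfl
  · rintro (⟨⟨a, ha⟩⟩ | ⟨⟨a, ha⟩⟩)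
    · change F _ = _
      simp only [F, ha, dite_true]
    · have h : a ∉ G₁.vertexSet := fun h => Set.disjoint_left.1 hdisj h ha
      change F _ = _
      simp only [F, h, dite_false]

open MvPolynomial Finset

open Classical in
/-- An auxiliary sum over the spanning subgraphs with edge set contained in `E`. -/
noncomputable def subsetSum (c : β → Λ) (G : Graph α β) (E : Finset β) :
    MvPolynomial (WVar Λ) ℤ :=
  ∑ S ∈ E.powerset, (∏ e ∈ S, X (.x (c e))) * (∏ e ∈ E \ S, X (.y (c e))) *
    (X .z₁ ^ (G.restrict (S : Set β)).componentCount *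
      X .z₂ ^ (S.card + (G.restrict (S : Set β)).componentCount))

open Classical in
theorem subsetSum_congr (c : β → Λ) {G H : Graph α β} {E : Finset β}
    (h : ∀ S ⊆ E, (G.restrict (S : Set β)).componentCount =
      (H.restrict (S : Set β)).componentCount) : subsetSum c G E = subsetSum c H E := by
  refine Finset.sum_congr rfl fun S hS => ?_
  rw [h S (Finset.mem_powerset.1 hS)]

open Classical in
theorem subsetSum_insert (c : β → Λ) {G : Graph α β} {E : Finset β} {e : β} {u v : α}
    (he : G.IsLink e u v) (heE : e ∉ E) :
    subsetSum c G (insert e E) = X (.x (c e)) * X .z₂ * subsetSum c (G.contractEdge e u v) E +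
      X (.y (c e)) * subsetSum c (G.deleteEdges {e}) E := by
  unfold subsetSum
  rw [Finset.sum_powerset_insert heE, add_comm, Finset.mul_sum, Finset.mul_sum]
  congr 1
  · refine Finset.sum_congr rfl fun S hS => ?_
    have hS := Finset.mem_powerset.1 hS
    have heS : e ∉ S := fun h => heE (hS h)
    have hk : ((G.contractEdge e u v).restrict (S : Set β)).componentCount =
        (G.restrict ((insert e S : Finset β) : Set β)).componentCount := by
      rw [Finset.coe_insert, ← restrict_insert_contract (by simpa using heS)]
      exact componentCount_contract (by simp [he])
    rw [hk, Finset.prod_insert heS, Finset.card_insert_of_notMem heS,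
      Finset.insert_sdiff_insert, Finset.sdiff_insert_of_notMem heE]
    ring
  · refine Finset.sum_congr rfl fun S hS => ?_
    have hS := Finset.mem_powerset.1 hS
    have heS : e ∉ S := fun h => heE (hS h)
    rw [restrict_delete (by simpa using heS), Finset.insert_sdiff_of_notMem _ heS,
      Finset.prod_insert (fun h => heE (Finset.mem_sdiff.1 h).1)]
    ring

open Classical in
theorem subsetSum_bridge [Finite α] (c : β → Λ) {G : Graph α β} {E : Finset β} {e : β} {u v : α}
    (he : G.IsLink e u v) (hb : G.IsBridge e) (heE : e ∉ E) :
    subsetSum c (G.deleteEdges {e}) E =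
      X .z₁ * X .z₂ * subsetSum c (G.contractEdge e u v) E := by
  unfold subsetSum
  rw [Finset.mul_sum]
  refine Finset.sum_congr rfl fun S hS => ?_
  have hS := Finset.mem_powerset.1 hS
  have heS : e ∉ (S : Set β) := fun h => heE (hS h)
  have hk : ((G.contractEdge e u v).restrict (S : Set β)).componentCount =
      (G.restrict (insert e (S : Set β))).componentCount := by
    rw [← restrict_insert_contract heS]
    exact componentCount_contract (by simp [he])
  rw [hk, restrict_delete heS, ← componentCount_bridge he hb heS]
  ring

open Classical in
theorem subsetSum_union [Finite α] (c : β → Λ) {G G₁ G₂ : Graph α β} {E₁ E₂ : Finset β}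
    (hE₁ : (E₁ : Set β) = G₁.edgeSet) (hE₂ : (E₂ : Set β) = G₂.edgeSet)
    (hE : Disjoint E₁ E₂)
    (hdisj : Disjoint G₁.vertexSet G₂.vertexSet)
    (hV : G.vertexSet = G₁.vertexSet ∪ G₂.vertexSet)
    (hlink : ∀ e u v, G.IsLink e u v ↔ G₁.IsLink e u v ∨ G₂.IsLink e u v) :
    subsetSum c G (E₁ ∪ E₂) = subsetSum c G₁ E₁ * subsetSum c G₂ E₂ := by
  unfold subsetSum
  rw [Finset.sum_mul_sum, ← Finset.sum_product']
  symm
  have hd : ∀ {S T : Finset β}, S ⊆ E₁ → T ⊆ E₂ → Disjoint S T := fun h1 h2 =>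
    Finset.disjoint_of_subset_left h1 (Finset.disjoint_of_subset_right h2 hE)
  refine Finset.sum_bij' (fun p _ => p.1 ∪ p.2) (fun S _ => (S ∩ E₁, S ∩ E₂)) ?_ ?_ ?_ ?_ ?_
  · rintro ⟨S, T⟩ h
    simp only [Finset.mem_product, Finset.mem_powerset] at h ⊢
    exact Finset.union_subset_union h.1 h.2
  · intro S _
    simp
  · rintro ⟨S, T⟩ h
    simp only [Finset.mem_product, Finset.mem_powerset] at h
    have h1 : T ∩ E₁ = ∅ := Finset.disjoint_iff_inter_eq_empty.1
      (Finset.disjoint_of_subset_left h.2 hE.symm)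
    have h2 : S ∩ E₂ = ∅ := Finset.disjoint_iff_inter_eq_empty.1
      (Finset.disjoint_of_subset_left h.1 hE)
    simp [Finset.union_inter_distrib_right, h1, h2, Finset.inter_eq_left.2 h.1,
      Finset.inter_eq_left.2 h.2]
  · intro S hS
    have := Finset.mem_powerset.1 hS
    change S ∩ E₁ ∪ S ∩ E₂ = S
    rw [← Finset.inter_union_distrib_left, Finset.inter_eq_left.2 this]
  · rintro ⟨S, T⟩ h
    simp only [Finset.mem_product, Finset.mem_powerset] at h
    dsimp only
    have hST := hd h.1 h.2
    have hsd : (E₁ ∪ E₂) \ (S ∪ T) = (E₁ \ S) ∪ (E₂ \ T) := by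
      ext f
      have a1 := @h.1 f
      have a2 := @h.2 f
      have a3 : f ∈ E₁ → f ∉ E₂ := fun hf => Finset.disjoint_left.1 hE hf
      simp only [Finset.mem_sdiff, Finset.mem_union]
      tauto
    have hsd' : Disjoint (E₁ \ S) (E₂ \ T) := hd Finset.sdiff_subset Finset.sdiff_subset
    have hk : (G.restrict ((S ∪ T : Finset β) : Set β)).componentCount =
        (G₁.restrict (S : Set β)).componentCount + (G₂.restrict (T : Set β)).componentCount := by
      refine componentCount_union hdisj hV ?_
      intro a b
      simp only [Graph.Adj, Graph.restrict_isLink, Finset.coe_union, Set.mem_union,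
        Finset.mem_coe, ← exists_or]
      refine exists_congr fun f => ?_
      rw [hlink]
      have b1 : G₁.IsLink f a b → f ∈ E₁ := fun hf => by
        have := hf.edge_mem; rw [← hE₁] at this; exact this
      have b2 : G₂.IsLink f a b → f ∈ E₂ := fun hf => by
        have := hf.edge_mem; rw [← hE₂] at this; exact this
      have a1 := @h.1 f
      have a2 := @h.2 f
      have a3 : f ∈ E₁ → f ∉ E₂ := fun hf => Finset.disjoint_left.1 hE hf
      tauto
    rw [hk, hsd, Finset.prod_union hST, Finset.prod_union hsd', Finset.card_union_of_disjoint hST]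
    ring

open Classical in
theorem eq_subsetSum [Finite α] [Fintype β] {c : β → Λ} {G : Graph α β}
    {p : MvPolynomial (WVar Λ) ℤ} (h : IsWPolynomial c G p) :
    p * (X .z₁ ^ G.componentCount * X .z₂ ^ G.vertexSet.ncard * X .t) =
      X .t ^ G.componentCount * subsetSum c G G.edgeSet.toFinset := by
  have hins : ∀ (H : Graph α β) (e : β) (u v : α), H.IsLink e u v →
      H.edgeSet.toFinset = insert e (H.edgeSet \ {e}).toFinset ∧
      e ∉ (H.edgeSet \ {e}).toFinset := by
    intro H e u v he
    refine ⟨?_, by simp⟩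
    ext f
    have := he.edge_mem
    by_cases hf : f = e
    · subst hf; simp [this]
    · simp [hf]
  induction h with
  | edgeless G hE hfin hne =>
    have hpos : 0 < G.vertexSet.ncard := (Set.ncard_pos hfin).2 hne
    have h0 : G.edgeSet.toFinset = ∅ := by simp [hE]
    rw [h0]
    have hk : (G.restrict ((∅ : Finset β) : Set β)).componentCount = G.vertexSet.ncard := by
      rw [componentCount_edgeless (by simp)]; rfl
    obtain ⟨n, hn⟩ : ∃ n, G.vertexSet.ncard = n + 1 := ⟨_, (Nat.succ_pred_eq_of_pos hpos).symm⟩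
    simp only [subsetSum, Finset.powerset_empty, Finset.sum_singleton, hk,
      componentCount_edgeless hE, hn]
    simp
    ring
  | bridge G e u v p he hb hp ih =>
    obtain ⟨h1, h2⟩ := hins G e u v he
    rw [h1, subsetSum_insert c he h2, subsetSum_bridge c he hb h2]
    have huv : u ≠ v := by
      rintro rfl
      have := componentCount_loop he
      exact absurd hb.2 (by omega)
    rw [componentCount_contract he] at ih
    rw [← ncard_contract he huv]
    have hE : (G.contractEdge e u v).edgeSet.toFinset = (G.edgeSet \ {e}).toFinset :=
      Set.toFinset_congr rfl
    rw [hE] at ih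
    linear_combination (X (.x (c e)) + X .z₁ * X (.y (c e))) * X .z₂ * ih
  | loop G e u p he hp ih =>
    have he : G.IsLink e u u := he
    obtain ⟨h1, h2⟩ := hins G e u u he
    rw [h1, subsetSum_insert c he h2]
    have hcd : G.contractEdge e u u = G.deleteEdges {e} := by
      unfold Graph.contractEdge
      have : Function.update (id : α → α) u u = id :=
        Function.update_eq_self u (id : α → α)
      rw [this]
      refine Graph.ext (by simp) ?_
      intro f a b
      simp
    rw [componentCount_loop he] at ih
    have hE : (G.deleteEdges {e}).edgeSet.toFinset = (G.edgeSet \ {e}).toFinset :=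
      Set.toFinset_congr rfl
    rw [hE] at ih
    have hVn : (G.deleteEdges {e}).vertexSet.ncard = G.vertexSet.ncard := rfl
    rw [hVn] at ih
    rw [hcd]
    linear_combination (X (.x (c e)) * X .z₂ + X (.y (c e))) * ih
  | ordinary G e u v p q he huv hb hp hq ihp ihq =>
    obtain ⟨h1, h2⟩ := hins G e u v he
    rw [h1, subsetSum_insert c he h2]
    rw [componentCount_contract he] at ihp
    rw [componentCount_nonbridge he hb] at ihq
    have hE : (G.contractEdge e u v).edgeSet.toFinset = (G.edgeSet \ {e}).toFinset :=
      Set.toFinset_congr rfl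
    have hE' : (G.deleteEdges {e}).edgeSet.toFinset = (G.edgeSet \ {e}).toFinset :=
      Set.toFinset_congr rfl
    rw [hE] at ihp
    rw [hE'] at ihq
    have hVn : (G.deleteEdges {e}).vertexSet.ncard = G.vertexSet.ncard := rfl
    rw [hVn, ← ncard_contract he huv] at ihq
    rw [← ncard_contract he huv]
    linear_combination X (.x (c e)) * X .z₂ * ihp + X (.y (c e)) * ihq
  | disjointUnion G G₁ G₂ p q hdisj hV hlink hp hq ihp ihq =>
    have hEd : Disjoint G₁.edgeSet.toFinset G₂.edgeSet.toFinset := by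
      rw [Finset.disjoint_left]
      intro e h1 h2
      obtain ⟨a, b, hab⟩ := (G₁.edge_mem_iff_exists_isLink e).1 (Set.mem_toFinset.1 h1)
      obtain ⟨a', b', hab'⟩ := (G₂.edge_mem_iff_exists_isLink e).1 (Set.mem_toFinset.1 h2)
      have g1 := (hlink e a b).2 (Or.inl hab)
      have g2 := (hlink e a' b').2 (Or.inr hab')
      rcases G.eq_or_eq_of_isLink_of_isLink g1 g2 with h | h
      · exact Set.disjoint_left.1 hdisj hab.left_mem (h ▸ hab'.left_mem)
      · exact Set.disjoint_left.1 hdisj hab.left_mem (h ▸ hab'.right_mem)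
    have hEu : G.edgeSet.toFinset = G₁.edgeSet.toFinset ∪ G₂.edgeSet.toFinset := by
      ext e
      simp only [Set.mem_toFinset, Finset.mem_union, Graph.edge_mem_iff_exists_isLink, hlink,
        exists_or]
    rw [hEu, subsetSum_union c (by simp) (by simp) hEd hdisj hV hlink,
      componentCount_union hdisj hV (by
        intro a b; simp only [Graph.Adj, hlink, exists_or]),
      hV, Set.ncard_union_eq hdisj (Set.toFinite _) (Set.toFinite _)]
    rw [pow_add, pow_add, pow_add]
    linear_combination (q * (X .z₁ ^ G₂.componentCount * X .z₂ ^ G₂.vertexSet.ncard * X .t)) * ihp +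
      (X .t ^ G₁.componentCount * subsetSum c G₁ G₁.edgeSet.toFinset) * ihq

theorem exists_isWPolynomial [Finite α] [Finite β] (c : β → Λ) (n : ℕ) :
    ∀ G : Graph α β, G.vertexSet.Nonempty → G.edgeSet.ncard = n → ∃ p, IsWPolynomial c G p := by
  induction n with
  | zero =>
    intro G hne hn
    exact ⟨_, .edgeless G ((Set.ncard_eq_zero (Set.toFinite _)).1 hn) (Set.toFinite _) hne⟩
  | succ n ih =>
    intro G hne hn
    obtain ⟨e, heE⟩ : G.edgeSet.Nonempty := (Set.ncard_pos (Set.toFinite _)).1 (by omega)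
    obtain ⟨u, v, he⟩ := (G.edge_mem_iff_exists_isLink e).1 heE
    have hcard : (G.edgeSet \ {e}).ncard = n := by
      have := Set.ncard_sdiff_singleton_add_one heE (Set.toFinite _)
      omega
    obtain ⟨p, hp⟩ := ih (G.contractEdge e u v) (hne.image _) hcard
    obtain ⟨q, hq⟩ := ih (G.deleteEdges {e}) hne hcard
    by_cases hb : G.IsBridge e
    · exact ⟨_, .bridge G e u v p he hb hp⟩
    by_cases huv : u = v
    · subst huv; exact ⟨_, .loop G e u q he hq⟩
    · exact ⟨_, .ordinary G e u v p q he huv hb hp hq⟩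

end WPolynomialAux

/-- On a finite nonempty multigraph the recursive rules determine exactly one polynomial,
whatever the order in which they are applied. -/
theorem existsUnique_isWPolynomial {α β Λ : Type*} [Finite α] [Finite β] (c : β → Λ)
    (G : Graph α β) (hG : G.vertexSet.Nonempty) : ∃! p, IsWPolynomial c G p := by
  classical
  have := Fintype.ofFinite β
  obtain ⟨p, hp⟩ := WPolynomialAux.exists_isWPolynomial c _ G hG rfl
  refine ⟨p, hp, fun q hq => ?_⟩
  have h := (WPolynomialAux.eq_subsetSum hq).trans (WPolynomialAux.eq_subsetSum hp).symm
  refine mul_right_cancel₀ ?_ h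
  exact mul_ne_zero (mul_ne_zero (pow_ne_zero _ (MvPolynomial.X_ne_zero _))
    (pow_ne_zero _ (MvPolynomial.X_ne_zero _))) (MvPolynomial.X_ne_zero _)

open Classical in
/-- The W-polynomial of a finite nonempty multigraph with edge colouring `c`: the polynomial given
by the recursive rules (and `0` where they give none). -/
noncomputable def wPolynomial {α β Λ : Type*} (c : β → Λ) (G : Graph α β) :
    MvPolynomial (WVar Λ) ℤ :=
  if h : ∃ p, IsWPolynomial c G p then h.choose else 0

theorem isWPolynomial_wPolynomial {α β Λ : Type*} [Finite α] [Finite β] (c : β → Λ)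
    (G : Graph α β) (hG : G.vertexSet.Nonempty) : IsWPolynomial c G (wPolynomial c G) := by
  have h := (existsUnique_isWPolynomial c G hG).exists
  unfold wPolynomial
  rw [dif_pos h]
  exact h.choose_spec

/-! ### Multigraphs embedded in an oriented surface, and plane multigraphs -/

/-- A multigraph with vertex type `V` and edge type `E`, cellularly embedded in an oriented surface
(up to homeomorphism; every connected component on a surface of its own), as a rotation system.
Each edge `e` has two darts (half-edges) `(e, false)` and `(e, true)`, one at each end. -/
structure EmbeddedGraph (V E : Type*) where
  /-- The vertex at which a dart sits. -/
  base : E × Bool → V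
  /-- The next dart at the same vertex, in counterclockwise order. -/
  rot : Equiv.Perm (E × Bool)
  /-- The rotation permutes the darts at each vertex cyclically. -/
  sameCycle_iff : ∀ a b, rot.SameCycle a b ↔ base a = base b

namespace EmbeddedGraph

variable {V E : Type*}

/-- The underlying abstract multigraph. -/
def graph (G : EmbeddedGraph V E) : Graph V E where
  vertexSet := Set.univ
  IsLink e u v := (G.base (e, false) = u ∧ G.base (e, true) = v) ∨
    (G.base (e, false) = v ∧ G.base (e, true) = u)
  edgeSet := Set.univ
  isLink_symm _ _ := ⟨fun _ _ h => h.symm⟩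
  eq_or_eq_of_isLink_of_isLink := by
    rintro e x y v w (⟨rfl, rfl⟩ | ⟨rfl, rfl⟩) (⟨rfl, rfl⟩ | ⟨rfl, rfl⟩) <;> simp
  edge_mem_iff_exists_isLink e := by
    simp only [Set.mem_univ, true_iff]
    exact ⟨_, _, Or.inl ⟨rfl, rfl⟩⟩
  left_mem_of_isLink := by intros; trivial

/-- The permutation of the darts that walks around the faces: traverse the edge of a dart from its
base to its other end, keeping the face on the left, and continue with the next dart there in
clockwise order. -/
def facePerm (G : EmbeddedGraph V E) : Equiv.Perm (E × Bool) :=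
  (Equiv.prodCongr (Equiv.refl E) Equiv.boolNot).trans G.rot.symm

/-- The number of vertices without darts. -/
noncomputable def isolatedCount (G : EmbeddedGraph V E) : ℕ :=
  Nat.card {v : V // ∀ a, G.base a ≠ v}

/-- The number of faces: the cycles of the face permutation, and one face for each component that
is a single vertex without edges. -/
noncomputable def faceCount (G : EmbeddedGraph V E) : ℕ :=
  Nat.card (Quotient (Equiv.Perm.SameCycle.setoid G.facePerm)) + G.isolatedCount

/-- The embedding is planar: the surface is a sphere for every connected component, that is, the
Euler characteristic is twice the number of components. -/
def IsPlane (G : EmbeddedGraph V E) : Prop :=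
  Nat.card V + G.faceCount = Nat.card E + 2 * G.graph.componentCount

end EmbeddedGraph

/-! ### Wiring diagrams and the twist bracket -/

/-- The two types of vertices (twist sites) of a wiring diagram. -/
inductive TwistType where
  | horizontal
  | vertical

/-- The four ends at a twist site, in counterclockwise order: north-east, north-west, south-west,
south-east. -/
inductive SiteEnd where
  | ne
  | nw
  | sw
  | se

/-- A wiring diagram with twist sites indexed by `T`: a 4-valent graph (closed curves without
vertices being allowed), with the four ends at each vertex placed in the cyclic order of `SiteEnd`,
whose vertices are horizontal or vertical. Planarity is not a field, as neither the states nor the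
twist bracket depend on it; the wiring diagram of a plane graph is drawn on the same sphere. -/
structure WiringDiagram (T : Type*) where
  /-- The type of each vertex. -/
  type : T → TwistType
  /-- The edges of the 4-valent graph: the other end of the edge that starts at a given end. -/
  strand : T × SiteEnd → T × SiteEnd
  strand_strand : ∀ a, strand (strand a) = a
  strand_ne : ∀ a, strand a ≠ a
  /-- The number of closed curves without vertices. -/
  freeCircles : ℕ

/-- The two arcs `NW - NE` and `SW - SE`: they leave a passage between the regions in the west and
in the east. -/
def SiteEnd.horizontalArcs : SiteEnd → SiteEnd
  | .ne => .nw
  | .nw => .ne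
  | .sw => .se
  | .se => .sw

/-- The two arcs `NW - SW` and `NE - SE`: they separate the regions in the west and in the east. -/
def SiteEnd.verticalArcs : SiteEnd → SiteEnd
  | .ne => .se
  | .se => .ne
  | .nw => .sw
  | .sw => .nw

/-- The fillings of a twist site: the 0-filling has the two arcs parallel to the direction of the
twist (horizontal or vertical), the 1-filling has the other two arcs. -/
def TwistType.filling : TwistType → Fin 2 → SiteEnd → SiteEnd
  | .horizontal, 0 => SiteEnd.horizontalArcs
  | .horizontal, 1 => SiteEnd.verticalArcs
  | .vertical, 0 => SiteEnd.verticalArcs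
  | .vertical, 1 => SiteEnd.horizontalArcs

/-- The loop value `d = -A⁻² - A²`. -/
def loopValue {K : Type*} [Field K] (A : K) : K := -(A ^ 2)⁻¹ - A ^ 2

/-- The Kauffman bracket of a diagram without crossings that consists of `n` closed curves: a
single curve has bracket `1`, every further one multiplies the bracket by `d`. -/
def crossinglessBracket {K : Type*} [Field K] (A : K) (n : ℕ) : K :=
  loopValue A ^ ((n : ℤ) - 1)

namespace WiringDiagram

variable {T : Type*}

/-- The number of closed curves of the state `L_σ`, in which the site `i` has the `σ i`-filling:
two ends are on the same curve if they are linked by strands and arcs of fillings. -/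
noncomputable def stateCircles (L : WiringDiagram T) (σ : T → Fin 2) : ℕ :=
  Nat.card (Quot fun a b : T × SiteEnd =>
    b = L.strand a ∨ b = (a.1, (L.type a.1).filling (σ a.1) a.2)) + L.freeCircles

/-- The twist bracket
`P_L(A, x) = ∑_σ (∏_i (x_i - 1) ^ σ_i * d ^ (1 - σ_i)) * ⟨L_σ⟩` of a wiring diagram. -/
noncomputable def twistBracket {K : Type*} [Field K] [Fintype T] [DecidableEq T]
    (L : WiringDiagram T) (A : K) (x : T → K) : K :=
  ∑ σ : T → Fin 2,
    (∏ i, (x i - 1) ^ (σ i : ℕ) * loopValue A ^ (1 - (σ i : ℕ))) *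
      crossinglessBracket A (L.stateCircles σ)

end WiringDiagram

/-! ### The wiring diagram of a coloured graph -/

/-- The colours of the edges: `c` for chains, `s` for sheafs. -/
inductive EdgeColor where
  | c
  | s

/-- A sheaf becomes a vertical vertex, a chain becomes a horizontal vertex. -/
def EdgeColor.twistType : EdgeColor → TwistType
  | .c => .horizontal
  | .s => .vertical

namespace EmbeddedGraph

variable {V E : Type*}

/-- The end of the site on the clockwise side of a dart, seen from its vertex, where the vertices of
the darts `(e, true)` and `(e, false)` lie in the east and in the west of the site on `e`. -/
def clockwiseEnd {E : Type*} : E × Bool → E × SiteEnd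
  | (e, true) => (e, .ne)
  | (e, false) => (e, .sw)

/-- The end of the site on the counterclockwise side of a dart, seen from its vertex. -/
def counterclockwiseEnd {E : Type*} : E × Bool → E × SiteEnd
  | (e, true) => (e, .se)
  | (e, false) => (e, .nw)

/-- Every edge `e` is crossed by the wiring diagram in one site, with the vertex of the dart
`(e, true)` in the east and the vertex of the dart `(e, false)` in the west, so that the regions in
the east and in the west are shaded. The strand on the counterclockwise side of a dart (seen from
its vertex) runs along the boundary of the shaded region to the clockwise side of the next dart. -/
def medialStrand (G : EmbeddedGraph V E) : E × SiteEnd → E × SiteEnd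
  | (e, .se) => clockwiseEnd (G.rot (e, true))
  | (e, .nw) => clockwiseEnd (G.rot (e, false))
  | (e, .ne) => counterclockwiseEnd (G.rot.symm (e, true))
  | (e, .sw) => counterclockwiseEnd (G.rot.symm (e, false))

theorem medialStrand_clockwiseEnd (G : EmbeddedGraph V E) (a : E × Bool) :
    G.medialStrand (clockwiseEnd a) =
      counterclockwiseEnd (G.rot.symm a) := by
  rcases a with ⟨e, _ | _⟩ <;> rfl

theorem medialStrand_counterclockwiseEnd (G : EmbeddedGraph V E) (a : E × Bool) :
    G.medialStrand (counterclockwiseEnd a) =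
      clockwiseEnd (G.rot a) := by
  rcases a with ⟨e, _ | _⟩ <;> rfl

theorem siteEnd_cases {E : Type*} (a : E × SiteEnd) : (∃ b : E × Bool, a = clockwiseEnd b) ∨
    ∃ b : E × Bool, a = counterclockwiseEnd b := by
  rcases a with ⟨e, _ | _ | _ | _⟩
  · exact Or.inl ⟨(e, true), rfl⟩
  · exact Or.inr ⟨(e, false), rfl⟩
  · exact Or.inl ⟨(e, false), rfl⟩
  · exact Or.inr ⟨(e, true), rfl⟩

theorem clockwiseEnd_ne {E : Type*} (a b : E × Bool) :
    clockwiseEnd a ≠ counterclockwiseEnd b := by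
  rcases a with ⟨e, _ | _⟩ <;> rcases b with ⟨f, _ | _⟩ <;>
    simp [clockwiseEnd, counterclockwiseEnd]

/-- The wiring diagram `W_G` of an embedded graph `G` with edges coloured by `c` and `s`: its
vertices are the edges of `G`, and its shaded regions are the vertices of `G`. A vertex of `G`
without edges contributes a closed curve, the boundary of its shaded region. -/
noncomputable def wiringDiagram (G : EmbeddedGraph V E) (color : E → EdgeColor) :
    WiringDiagram E where
  type e := (color e).twistType
  strand := G.medialStrand
  strand_strand a := by
    rcases siteEnd_cases a with ⟨b, rfl⟩ | ⟨b, rfl⟩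
    · rw [medialStrand_clockwiseEnd, medialStrand_counterclockwiseEnd, Equiv.apply_symm_apply]
    · rw [medialStrand_counterclockwiseEnd, medialStrand_clockwiseEnd, Equiv.symm_apply_apply]
  strand_ne a := by
    rcases siteEnd_cases a with ⟨b, rfl⟩ | ⟨b, rfl⟩
    · rw [medialStrand_clockwiseEnd]; exact (clockwiseEnd_ne _ _).symm
    · rw [medialStrand_counterclockwiseEnd]; exact clockwiseEnd_ne _ _
  freeCircles := G.isolatedCount

end EmbeddedGraph

/-! ### The augmented colouring and the evaluation of the variables -/

/-- The augmented colours `c_i` and `s_i`, one pair for each edge `i`. -/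
inductive AugColor (E : Type*) where
  | c : E → AugColor E
  | s : E → AugColor E

/-- The augmented colouring: the edge `i` gets the colour `c_i` or `s_i`. -/
def augment {E : Type*} (color : E → EdgeColor) (i : E) : AugColor E :=
  match color i with
  | .c => .c i
  | .s => .s i

/-- The evaluation `t = z₁ = z₂ = d`, `x_{c_i} = 1`, `y_{c_i} = (x_i - 1) / d`,
`x_{s_i} = (x_i - 1) / d`, `y_{s_i} = 1`. -/
def twistEvaluation {K E : Type*} [Field K] (d : K) (x : E → K) : WVar (AugColor E) → K
  | .t => d
  | .z₁ => d
  | .z₂ => d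
  | .x (.c _) => 1
  | .y (.c i) => (x i - 1) / d
  | .x (.s i) => (x i - 1) / d
  | .y (.s _) => 1

/-!
Expand both sides over the spanning subgraphs of `G`, given by their edge sets `S`; let `n` be the
number of vertices and `k(S)` the number of components. For `t = z₁ = z₂ = d` the expansion of the
W-polynomial reads `d ^ (n + 1) * W = ∑ S, x ^ S * y ^ Sᶜ * d ^ (|S| + 2 k(S))`. The state of the
wiring diagram that joins the shaded regions exactly at the edges in `S` consists of the boundary
curves of the ribbon neighbourhood of `S`, and its weight is `d ^ E * x ^ S * y ^ Sᶜ`. So the claim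
is Euler's formula: `S` has `|S| + 2 k(S) - n` boundary curves. It holds since the genus of the
ribbon neighbourhood does not decrease when an edge is added, while it vanishes both for `S = ∅`
and, by planarity, for the set of all edges.
-/

/-! ### Numbers of classes and of cycles -/

section Cycles

open Equiv Equiv.Perm

variable {X Y : Type*}

theorem card_quot_congr {r s : X → X → Prop} (hrs : ∀ x y, r x y → Quot.mk s x = Quot.mk s y)
    (hsr : ∀ x y, s x y → Quot.mk r x = Quot.mk r y) : Nat.card (Quot r) = Nat.card (Quot s) :=
  Nat.card_congr
    { toFun := Quot.lift (Quot.mk s) hrs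
      invFun := Quot.lift (Quot.mk r) hsr
      left_inv := by rintro ⟨x⟩; rfl
      right_inv := by rintro ⟨x⟩; rfl }

/-- The number of cycles of a permutation, fixed points included. -/
noncomputable def cycleCount (p : Perm X) : ℕ :=
  Nat.card (Quotient (SameCycle.setoid p))

theorem cycleCount_inv (p : Perm X) : cycleCount p⁻¹ = cycleCount p := by
  have : SameCycle.setoid p⁻¹ = SameCycle.setoid p := Setoid.ext fun _ _ => sameCycle_inv
  rw [cycleCount, this, cycleCount]

theorem eq_of_sameCycle {p : Perm X} {f : X → Y} (hf : ∀ x, f (p x) = f x) {x y : X}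
    (h : p.SameCycle x y) : f x = f y := by
  obtain ⟨i, rfl⟩ := h
  induction i with
  | zero => rfl
  | succ i ih => rw [add_comm, zpow_add, zpow_one, mul_apply, hf, ih]
  | pred i ih => rw [ih, ← hf ((p ^ (-(i : ℤ) - 1)) x), ← mul_apply, ← zpow_one_add, add_sub_cancel]

variable [DecidableEq X] {p : Perm X} {a b : X}

theorem sameCycle_of_sameCycle_swap_mul (hab : p.SameCycle a b) {x y : X}
    (h : (swap a b * p).SameCycle x y) : p.SameCycle x y := by
  let cycle : X → Quotient (SameCycle.setoid p) := Quotient.mk _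
  have hcycle : cycle a = cycle b := Quotient.sound hab
  refine Quotient.exact (eq_of_sameCycle (f := cycle) (fun x => ?_) h)
  rw [mul_apply, apply_swap_eq_self hcycle]
  exact Quotient.sound (sameCycle_apply_left.2 (.refl _ _))

theorem sameCycle_swap_mul [Finite X] (h : ¬ p.SameCycle a b) :
    (swap a b * p).SameCycle a b := by
  -- The cycle of `a` is left unchanged up to `p⁻¹ a`, which is now followed by `b`.
  have hpow : ∀ i : ℕ, (swap a b * p).SameCycle a ((p ^ i) a) := by
    intro i
    induction i with
    | zero => exact .refl _ _
    | succ i ih =>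
      have hb : p ((p ^ i) a) ≠ b := fun hb => h ⟨i + 1, by
        rw [add_comm, zpow_one_add, zpow_natCast, mul_apply, hb]⟩
      rw [pow_succ', mul_apply]
      by_cases ha : p ((p ^ i) a) = a
      · rw [ha]
      · rw [← sameCycle_apply_right, mul_apply, swap_apply_of_ne_of_ne ha hb] at ih
        exact ih
  obtain ⟨i, hi⟩ := (sameCycle_symm_apply_right.2 (.refl p a)).exists_nat_pow_eq
  have hlast := sameCycle_apply_right.2 (hpow i)
  rwa [hi, mul_apply, apply_symm_apply, swap_apply_left] at hlast

theorem cycleCount_swap_mul_of_not_sameCycle [Finite X] (h : ¬ p.SameCycle a b) :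
    cycleCount (swap a b * p) + 1 = cycleCount p := by
  let joined : X → X → Prop := fun x y =>
    p.SameCycle x y ∨ (x = a ∧ y = b) ∨ (x = b ∧ y = a)
  have hab : (swap a b * p).SameCycle a b := sameCycle_swap_mul h
  have hmk : Quot.mk joined a = Quot.mk joined b := Quot.sound (.inr (.inl ⟨rfl, rfl⟩))
  have hjoined : Nat.card (Quot joined) = cycleCount (swap a b * p) := by
    refine card_quot_congr ?_ fun x y hxy => eq_of_sameCycle (fun z => ?_) hxy
    · rintro x y (hxy | ⟨rfl, rfl⟩ | ⟨rfl, rfl⟩)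
      · rw [← swap_mul_self_mul a b p] at hxy
        exact Quot.sound (sameCycle_of_sameCycle_swap_mul hab hxy)
      · exact Quot.sound hab
      · exact Quot.sound hab.symm
    · rw [mul_apply, apply_swap_eq_self hmk]
      exact Quot.sound (.inl (sameCycle_apply_left.2 (.refl _ _)))
  rw [← hjoined]
  exact (WPolynomialAux.card_quot_add_edge fun _ _ => Iff.rfl).2 fun hmk' =>
    h (Quotient.exact (s := SameCycle.setoid p) hmk')

theorem cycleCount_swap_mul_le [Finite X] (p : Perm X) (a b : X) :
    cycleCount (swap a b * p) ≤ cycleCount p + 1 := by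
  by_cases hp : p.SameCycle a b
  · by_cases hq : (swap a b * p).SameCycle a b
    · have hle : cycleCount (swap a b * p) = cycleCount p := by
        refine card_quot_congr (fun x y hxy => ?_) fun x y hxy => ?_
        · exact Quot.sound (sameCycle_of_sameCycle_swap_mul hp hxy)
        · rw [← swap_mul_self_mul a b p] at hxy
          exact Quot.sound (sameCycle_of_sameCycle_swap_mul hq hxy)
      omega
    · have hsplit := cycleCount_swap_mul_of_not_sameCycle hq
      rw [swap_mul_self_mul] at hsplit
      omega
  · have hmerge := cycleCount_swap_mul_of_not_sameCycle hp
    omega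

end Cycles

/-! ### Components of spanning subgraphs and the W-polynomial -/

section SpanningSubgraphs

variable {α β Λ : Type*}

/-- The connected component of a vertex; the components are the classes that
`Graph.componentCount` counts. -/
def componentOf (H : Graph α β) (v : H.vertexSet) :
    Quot fun a b : H.vertexSet => H.Adj a b :=
  Quot.mk _ v

theorem componentCount_restrict_insert [Finite α] {H : Graph α β} {e : β} {u v : α}
    (he : H.IsLink e u v) {S : Set β} (heS : e ∉ S) :
    (componentOf (H.restrict S) ⟨u, he.left_mem⟩ = componentOf (H.restrict S) ⟨v, he.right_mem⟩ →
      (H.restrict (insert e S)).componentCount = (H.restrict S).componentCount) ∧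
    (componentOf (H.restrict S) ⟨u, he.left_mem⟩ ≠ componentOf (H.restrict S) ⟨v, he.right_mem⟩ →
      (H.restrict (insert e S)).componentCount + 1 = (H.restrict S).componentCount) := by
  have hlink : (H.restrict (insert e S)).IsLink e u v := by
    simp only [Graph.restrict_isLink, Set.mem_insert_iff, true_or, he, and_self]
  have hdelete : (H.restrict (insert e S)).deleteEdges {e} = H.restrict S := by
    rw [WPolynomialAux.restrict_insert_delete heS, WPolynomialAux.restrict_delete heS]
  have hadj := WPolynomialAux.adj_iff_of_link hlink
  rw [hdelete] at hadj
  exact WPolynomialAux.componentCount_add_edge (K := H.restrict S)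
    (K' := H.restrict (insert e S)) rfl he.left_mem he.right_mem hadj

theorem vertexSet_nonempty_of_componentCount_ne_zero {H : Graph α β} (h : H.componentCount ≠ 0) :
    H.vertexSet.Nonempty := by
  obtain ⟨⟨v⟩⟩ := (Nat.card_ne_zero.1 h).1
  exact ⟨v, v.2⟩

theorem aeval_wPolynomial_mul_pow [Finite α] [Finite β] [DecidableEq β] {R : Type*} [CommRing R]
    [NoZeroDivisors R] {φ : WVar Λ → R} {d : R} (hd : d ≠ 0) (ht : φ .t = d) (hz₁ : φ .z₁ = d)
    (hz₂ : φ .z₂ = d) (c : β → Λ) {H : Graph α β} (hV : H.vertexSet.Nonempty) {F : Finset β}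
    (hF : (F : Set β) = H.edgeSet) :
    MvPolynomial.aeval φ (wPolynomial c H) * d ^ (H.vertexSet.ncard + 1) =
      ∑ S ∈ F.powerset, (∏ e ∈ S, φ (.x (c e))) * (∏ e ∈ F \ S, φ (.y (c e))) *
        d ^ (S.card + 2 * (H.restrict (S : Set β)).componentCount) := by
  classical
  cases nonempty_fintype β
  have hF' : H.edgeSet.toFinset = F := by rw [← Finset.coe_inj, Set.coe_toFinset, hF]
  have hW := congrArg (MvPolynomial.aeval φ)
    (WPolynomialAux.eq_subsetSum (isWPolynomial_wPolynomial c H hV))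
  simp only [WPolynomialAux.subsetSum, map_mul, map_pow, map_sum, map_prod, MvPolynomial.aeval_X,
    ht, hz₁, hz₂] at hW
  refine mul_left_cancel₀ (pow_ne_zero H.componentCount hd) ?_
  calc d ^ H.componentCount *
        (MvPolynomial.aeval φ (wPolynomial c H) * d ^ (H.vertexSet.ncard + 1))
      = MvPolynomial.aeval φ (wPolynomial c H) *
          (d ^ H.componentCount * d ^ H.vertexSet.ncard * d) := by ring
    _ = _ := by
      rw [hW, hF']
      congr! 3 with S
      · congr!
      · ring

end SpanningSubgraphs

/-! ### Boundary curves of spanning subgraphs -/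

namespace EmbeddedGraph

variable {V E : Type*}

theorem isLink_base (G : EmbeddedGraph V E) (e : E) :
    G.graph.IsLink e (G.base (e, false)) (G.base (e, true)) :=
  Or.inl ⟨rfl, rfl⟩

theorem base_rot (G : EmbeddedGraph V E) (a : E × Bool) : G.base (G.rot a) = G.base a :=
  ((G.sameCycle_iff (G.rot a) a).1 (Equiv.Perm.sameCycle_apply_left.2 (.refl _ _)))

theorem cycleCount_rot (G : EmbeddedGraph V E) :
    cycleCount G.rot = Nat.card {v : V // ∃ a, G.base a = v} := by
  let vertex : Quotient (Equiv.Perm.SameCycle.setoid G.rot) → {v : V // ∃ a, G.base a = v} :=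
    Quotient.lift (fun a => ⟨G.base a, a, rfl⟩)
      fun a b h => Subtype.ext ((G.sameCycle_iff a b).1 h)
  refine Nat.card_congr (Equiv.ofBijective vertex ⟨?_, ?_⟩)
  · rintro ⟨a⟩ ⟨b⟩ h
    exact Quotient.sound ((G.sameCycle_iff a b).2 (congrArg Subtype.val h))
  · rintro ⟨v, a, rfl⟩
    exact ⟨⟦a⟧, rfl⟩

variable [DecidableEq E]

/-- The involution of the darts that exchanges the two darts of every edge in `S`. -/
def edgeFlip (S : Finset E) : Equiv.Perm (E × Bool) :=
  (Equiv.refl E).prodShear fun e => if e ∈ S then Equiv.boolNot else Equiv.refl Bool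

theorem edgeFlip_of_mem {S : Finset E} {e : E} (he : e ∈ S) (i : Bool) :
    edgeFlip S (e, i) = (e, !i) := by
  simp [edgeFlip, he]

theorem edgeFlip_of_notMem {S : Finset E} {e : E} (he : e ∉ S) (i : Bool) :
    edgeFlip S (e, i) = (e, i) := by
  simp [edgeFlip, he]

theorem edgeFlip_edgeFlip (S : Finset E) (a : E × Bool) : edgeFlip S (edgeFlip S a) = a := by
  rcases a with ⟨e, i⟩
  by_cases he : e ∈ S
  · rw [edgeFlip_of_mem he, edgeFlip_of_mem he, Bool.not_not]
  · rw [edgeFlip_of_notMem he, edgeFlip_of_notMem he]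

theorem edgeFlip_empty : edgeFlip (∅ : Finset E) = 1 :=
  Equiv.ext fun a => edgeFlip_of_notMem (Finset.notMem_empty a.1) a.2

theorem edgeFlip_insert {S : Finset E} {e : E} (he : e ∉ S) :
    edgeFlip (insert e S) = Equiv.swap (e, false) (e, true) * edgeFlip S := by
  ext1 ⟨f, i⟩
  rw [Equiv.Perm.mul_apply]
  by_cases hfe : f = e
  · subst hfe
    rw [edgeFlip_of_mem (Finset.mem_insert_self f S), edgeFlip_of_notMem he]
    cases i <;> simp
  · have hswap (j : Bool) : Equiv.swap (e, false) (e, true) (f, j) = (f, j) :=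
      Equiv.swap_apply_of_ne_of_ne (by simp [hfe]) (by simp [hfe])
    by_cases hfS : f ∈ S
    · rw [edgeFlip_of_mem (Finset.mem_insert_of_mem hfS), edgeFlip_of_mem hfS, hswap]
    · rw [edgeFlip_of_notMem (by simp [hfe, hfS]), edgeFlip_of_notMem hfS, hswap]

/-- The number of boundary curves of the ribbon neighbourhood of the spanning subgraph with edge
set `S`. A curve that leaves a vertex next to a dart of an edge in `S` runs along that edge to its
other dart; at an edge not in `S` it passes by. -/
noncomputable def boundaryCount (G : EmbeddedGraph V E) (S : Finset E) : ℕ :=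
  cycleCount (edgeFlip S * G.rot) + G.isolatedCount

theorem boundaryCount_empty [Finite V] (G : EmbeddedGraph V E) :
    G.boundaryCount ∅ = Nat.card V := by
  classical
  rw [boundaryCount, edgeFlip_empty, one_mul, cycleCount_rot, isolatedCount]
  simp only [ne_eq, ← not_exists]
  rw [← Nat.card_sum]
  exact Nat.card_congr (Equiv.sumCompl fun v => ∃ a, G.base a = v)

theorem boundaryCount_univ [Fintype E] (G : EmbeddedGraph V E) :
    G.boundaryCount Finset.univ = G.faceCount := by
  have hface : (edgeFlip Finset.univ * G.rot)⁻¹ = G.facePerm := by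
    rw [inv_eq_iff_mul_eq_one]
    ext1 ⟨e, i⟩
    simp [facePerm, edgeFlip_of_mem]
  rw [boundaryCount, ← cycleCount_inv, hface, cycleCount, faceCount]

/-- The component of a vertex in the spanning subgraph with edge set `S`. -/
def spanningComponent (G : EmbeddedGraph V E) (S : Finset E) (v : V) :
    Quot fun a b : (G.graph.restrict (S : Set E)).vertexSet =>
      (G.graph.restrict (S : Set E)).Adj a b :=
  componentOf (G.graph.restrict (S : Set E)) ⟨v, Set.mem_univ v⟩

theorem spanningComponent_base_edgeFlip (G : EmbeddedGraph V E) (S : Finset E) (a : E × Bool) :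
    G.spanningComponent S (G.base (edgeFlip S a)) = G.spanningComponent S (G.base a) := by
  rcases a with ⟨e, i⟩
  by_cases he : e ∈ S
  · have hlink : (G.graph.restrict (S : Set E)).IsLink e (G.base (e, false)) (G.base (e, true)) :=
      (Graph.restrict_isLink ..).mpr ⟨he, G.isLink_base e⟩
    rw [edgeFlip_of_mem he]
    cases i
    · exact Quot.sound ⟨e, hlink.symm⟩
    · exact Quot.sound ⟨e, hlink⟩
  · rw [edgeFlip_of_notMem he]

theorem spanningComponent_base_eq_of_sameCycle (G : EmbeddedGraph V E) {S : Finset E}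
    {a b : E × Bool} (h : (edgeFlip S * G.rot).SameCycle a b) :
    G.spanningComponent S (G.base a) = G.spanningComponent S (G.base b) :=
  eq_of_sameCycle (f := fun a => G.spanningComponent S (G.base a)) (fun a => by
    rw [Equiv.Perm.mul_apply, spanningComponent_base_edgeFlip, base_rot]) h

/-- Twice the genus of the closed surface obtained from the ribbon neighbourhood of the spanning
subgraph with edge set `S` by capping off its boundary curves, summed over the components. -/
noncomputable def twiceGenus (G : EmbeddedGraph V E) (S : Finset E) : ℤ :=
  2 * (G.graph.restrict (S : Set E)).componentCount + S.card - Nat.card V - G.boundaryCount S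

theorem twiceGenus_le_insert [Finite V] [Finite E] (G : EmbeddedGraph V E) {S : Finset E} {e : E}
    (he : e ∉ S) : G.twiceGenus S ≤ G.twiceGenus (insert e S) := by
  have hcomponents := componentCount_restrict_insert (G.isLink_base e) (Finset.mem_coe.not.2 he)
  unfold twiceGenus boundaryCount
  rw [Finset.card_insert_of_notMem he, Finset.coe_insert, edgeFlip_insert he, mul_assoc]
  by_cases hsame : G.spanningComponent S (G.base (e, false)) =
      G.spanningComponent S (G.base (e, true))
  · have hcount := hcomponents.1 hsame
    have hcycles := cycleCount_swap_mul_le (edgeFlip S * G.rot) (e, false) (e, true)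
    omega
  · have hcount := hcomponents.2 hsame
    have hcycles := cycleCount_swap_mul_of_not_sameCycle
      (mt G.spanningComponent_base_eq_of_sameCycle hsame)
    omega

theorem twiceGenus_mono [Finite V] [Finite E] (G : EmbeddedGraph V E) : Monotone G.twiceGenus :=
  Finset.monotone_iff_forall_le_insert.2 fun _ _ => G.twiceGenus_le_insert

theorem twiceGenus_empty [Finite V] (G : EmbeddedGraph V E) : G.twiceGenus ∅ = 0 := by
  have hcomponents : (G.graph.restrict ∅).componentCount = Nat.card V :=
    (WPolynomialAux.componentCount_edgeless (by simp)).trans (Set.ncard_univ V)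
  rw [twiceGenus, Finset.coe_empty, hcomponents, boundaryCount_empty, Finset.card_empty]
  omega

theorem IsPlane.twiceGenus_univ [Fintype E] {G : EmbeddedGraph V E} (hG : G.IsPlane) :
    G.twiceGenus Finset.univ = 0 := by
  have hrestrict : G.graph.restrict Set.univ = G.graph := G.graph.restrict_self
  rw [IsPlane, Nat.card_eq_fintype_card (α := E)] at hG
  rw [twiceGenus, Finset.coe_univ, hrestrict, boundaryCount_univ, Finset.card_univ]
  omega

theorem IsPlane.boundaryCount_add_card [Finite V] [Finite E] {G : EmbeddedGraph V E}
    (hG : G.IsPlane) (S : Finset E) :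
    G.boundaryCount S + Nat.card V =
      S.card + 2 * (G.graph.restrict (S : Set E)).componentCount := by
  cases nonempty_fintype E
  have hgenus : G.twiceGenus S = 0 := le_antisymm
    ((G.twiceGenus_mono S.subset_univ).trans_eq hG.twiceGenus_univ)
    (G.twiceGenus_empty.symm.trans_le (G.twiceGenus_mono S.empty_subset))
  unfold twiceGenus at hgenus
  omega

end EmbeddedGraph

/-! ### States of the wiring diagram -/

/-- The filling that connects the shaded regions at the site of an edge of the given colour. -/
def EdgeColor.connectingFilling : EdgeColor → Fin 2
  | .c => 0
  | .s => 1

theorem EdgeColor.filling_connectingFilling (k : EdgeColor) :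
    k.twistType.filling k.connectingFilling = SiteEnd.horizontalArcs := by
  cases k <;> rfl

theorem EdgeColor.filling_one_sub_connectingFilling (k : EdgeColor) :
    k.twistType.filling (1 - k.connectingFilling) = SiteEnd.verticalArcs := by
  cases k <;> rfl

/-- The other end of the arc that starts at a given end of a site in the state `σ`. -/
def WiringDiagram.siteArc {T : Type*} (L : WiringDiagram T) (σ : T → Fin 2) (a : T × SiteEnd) :
    T × SiteEnd :=
  (a.1, (L.type a.1).filling (σ a.1) a.2)

/-- The states correspond to the spanning subgraphs: the edge set `S` gives the state that connects
the shaded regions exactly at the edges in `S`. -/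
def connectingState {E : Type*} [Fintype E] [DecidableEq E] (color : E → EdgeColor) :
    Finset E ≃ (E → Fin 2) where
  toFun S e := if e ∈ S then (color e).connectingFilling else 1 - (color e).connectingFilling
  invFun σ := {e | σ e = (color e).connectingFilling}
  left_inv S := by
    have hne : ∀ i : Fin 2, 1 - i ≠ i := by decide
    ext e
    by_cases he : e ∈ S <;> simp [he, hne]
  right_inv σ := by
    have heq : ∀ i j : Fin 2, i ≠ j → 1 - j = i := by decide
    ext1 e
    by_cases he : σ e = (color e).connectingFilling
    · simp [he]
    · simp [he, heq _ _ he]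

namespace EmbeddedGraph

variable {V E : Type*} [DecidableEq E]

/-- The dart on the counterclockwise side of which the state curve through an end of a site leaves
the site, if the state connects the shaded regions exactly at the edges in `S`. -/
def dartOfEnd (S : Finset E) : E × SiteEnd → E × Bool
  | (e, .ne) => edgeFlip S (e, true)
  | (e, .sw) => edgeFlip S (e, false)
  | (e, .se) => (e, true)
  | (e, .nw) => (e, false)

theorem dartOfEnd_clockwiseEnd (S : Finset E) (a : E × Bool) :
    dartOfEnd S (clockwiseEnd a) = edgeFlip S a := by
  rcases a with ⟨e, _ | _⟩ <;> rfl

theorem dartOfEnd_counterclockwiseEnd (S : Finset E) (a : E × Bool) :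
    dartOfEnd S (counterclockwiseEnd a) = a := by
  rcases a with ⟨e, _ | _⟩ <;> rfl

theorem sameCycle_dartOfEnd_medialStrand (G : EmbeddedGraph V E) (S : Finset E)
    (a : E × SiteEnd) :
    (edgeFlip S * G.rot).SameCycle (dartOfEnd S a) (dartOfEnd S (G.medialStrand a)) := by
  rcases siteEnd_cases a with ⟨b, rfl⟩ | ⟨b, rfl⟩
  · rw [medialStrand_clockwiseEnd, dartOfEnd_clockwiseEnd, dartOfEnd_counterclockwiseEnd,
      ← Equiv.Perm.sameCycle_apply_right, Equiv.Perm.mul_apply, Equiv.apply_symm_apply]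
  · rw [medialStrand_counterclockwiseEnd, dartOfEnd_clockwiseEnd, dartOfEnd_counterclockwiseEnd,
      ← Equiv.Perm.mul_apply, Equiv.Perm.sameCycle_apply_right]

variable [Fintype E]

theorem siteArc_clockwiseEnd (G : EmbeddedGraph V E) (color : E → EdgeColor) (S : Finset E)
    (a : E × Bool) :
    (G.wiringDiagram color).siteArc (connectingState color S) (clockwiseEnd a) =
      counterclockwiseEnd (edgeFlip S a) := by
  rcases a with ⟨e, i⟩
  by_cases he : e ∈ S
  · cases i <;> simp [WiringDiagram.siteArc, wiringDiagram, connectingState, edgeFlip, he,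
      clockwiseEnd, counterclockwiseEnd, EdgeColor.filling_connectingFilling,
      SiteEnd.horizontalArcs]
  · cases i <;> simp [WiringDiagram.siteArc, wiringDiagram, connectingState, edgeFlip, he,
      clockwiseEnd, counterclockwiseEnd, EdgeColor.filling_one_sub_connectingFilling,
      SiteEnd.verticalArcs]

theorem siteArc_counterclockwiseEnd (G : EmbeddedGraph V E) (color : E → EdgeColor) (S : Finset E)
    (a : E × Bool) :
    (G.wiringDiagram color).siteArc (connectingState color S) (counterclockwiseEnd a) =
      clockwiseEnd (edgeFlip S a) := by
  rcases a with ⟨e, i⟩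
  by_cases he : e ∈ S
  · cases i <;> simp [WiringDiagram.siteArc, wiringDiagram, connectingState, edgeFlip, he,
      clockwiseEnd, counterclockwiseEnd, EdgeColor.filling_connectingFilling,
      SiteEnd.horizontalArcs]
  · cases i <;> simp [WiringDiagram.siteArc, wiringDiagram, connectingState, edgeFlip, he,
      clockwiseEnd, counterclockwiseEnd, EdgeColor.filling_one_sub_connectingFilling,
      SiteEnd.verticalArcs]

theorem dartOfEnd_siteArc (G : EmbeddedGraph V E) (color : E → EdgeColor) (S : Finset E)
    (a : E × SiteEnd) :
    dartOfEnd S ((G.wiringDiagram color).siteArc (connectingState color S) a) =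
      dartOfEnd S a := by
  rcases siteEnd_cases a with ⟨b, rfl⟩ | ⟨b, rfl⟩
  · rw [siteArc_clockwiseEnd, dartOfEnd_clockwiseEnd, dartOfEnd_counterclockwiseEnd]
  · rw [siteArc_counterclockwiseEnd, dartOfEnd_clockwiseEnd, dartOfEnd_counterclockwiseEnd,
      edgeFlip_edgeFlip]

theorem stateCircles_connectingState (G : EmbeddedGraph V E) (color : E → EdgeColor)
    (S : Finset E) :
    (G.wiringDiagram color).stateCircles (connectingState color S) = G.boundaryCount S := by
  let L := G.wiringDiagram color
  let joined : E × SiteEnd → E × SiteEnd → Prop := fun a b =>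
    b = L.strand a ∨ b = L.siteArc (connectingState color S) a
  let boundaryCurve : E × Bool → Quotient (Equiv.Perm.SameCycle.setoid (edgeFlip S * G.rot)) :=
    Quotient.mk _
  let curve : E × Bool → Quot joined := fun a => Quot.mk joined (counterclockwiseEnd a)
  have hboundary : ∀ a b, joined a b →
      boundaryCurve (dartOfEnd S a) = boundaryCurve (dartOfEnd S b) := by
    rintro a _ (rfl | rfl)
    · exact Quotient.sound (G.sameCycle_dartOfEnd_medialStrand S a)
    · rw [dartOfEnd_siteArc]
  have harc : ∀ a, Quot.mk joined (clockwiseEnd a) = curve (edgeFlip S a) := fun a =>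
    Quot.sound (.inr (G.siteArc_clockwiseEnd color S a).symm)
  have hcurve : ∀ a, curve ((edgeFlip S * G.rot) a) = curve a := fun a =>
    (harc (G.rot a)).symm.trans
      (Quot.sound (.inl (G.medialStrand_counterclockwiseEnd a).symm)).symm
  refine congrArg (· + G.isolatedCount) (Nat.card_congr
    { toFun := Quot.lift (fun a => boundaryCurve (dartOfEnd S a)) hboundary
      invFun := Quotient.lift curve fun _ _ => eq_of_sameCycle hcurve
      left_inv := ?_
      right_inv := ?_ })
  · rintro ⟨a⟩
    change curve (dartOfEnd S a) = Quot.mk joined a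
    rcases siteEnd_cases a with ⟨b, rfl⟩ | ⟨b, rfl⟩
    · rw [dartOfEnd_clockwiseEnd, harc]
    · rw [dartOfEnd_counterclockwiseEnd]
  · rintro ⟨a⟩
    exact congrArg boundaryCurve (dartOfEnd_counterclockwiseEnd S a)

end EmbeddedGraph

/-! ### The twist bracket as a sum over spanning subgraphs -/

section TwistBracket

variable {V E K : Type*} [DecidableEq E] [Field K]

theorem EmbeddedGraph.IsPlane.crossinglessBracket_boundaryCount_mul_pow [Finite V] [Finite E]
    {G : EmbeddedGraph V E} (hG : G.IsPlane) {A : K} (hd : loopValue A ≠ 0) (S : Finset E) :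
    crossinglessBracket A (G.boundaryCount S) * loopValue A ^ (Nat.card V + 1) =
      loopValue A ^ (S.card + 2 * (G.graph.restrict (S : Set E)).componentCount) := by
  rw [crossinglessBracket, ← hG.boundaryCount_add_card, ← zpow_natCast, ← zpow_natCast,
    ← zpow_add₀ hd]
  congr 1
  push_cast
  ring

variable [Fintype E]

theorem siteWeight_connectingState {d : K} (hd : d ≠ 0) (color : E → EdgeColor) (x : E → K)
    (S : Finset E) (e : E) :
    (x e - 1) ^ (connectingState color S e : ℕ) * d ^ (1 - (connectingState color S e : ℕ)) =
      d * S.piecewise (fun e => twistEvaluation d x (.x (augment color e)))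
        (fun e => twistEvaluation d x (.y (augment color e))) e := by
  by_cases he : e ∈ S <;> cases hc : color e <;>
    simp [connectingState, EdgeColor.connectingFilling, augment, twistEvaluation, he, hc,
      mul_div_cancel₀ _ hd]

theorem prod_siteWeight_connectingState {d : K} (hd : d ≠ 0) (color : E → EdgeColor) (x : E → K)
    (S : Finset E) :
    ∏ e, (x e - 1) ^ (connectingState color S e : ℕ) *
        d ^ (1 - (connectingState color S e : ℕ)) =
      d ^ Fintype.card E * ((∏ e ∈ S, twistEvaluation d x (.x (augment color e))) *
        ∏ e ∈ Finset.univ \ S, twistEvaluation d x (.y (augment color e))) := by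
  simp only [siteWeight_connectingState hd, Finset.prod_mul_distrib, Finset.prod_const,
    Finset.prod_piecewise, Finset.univ_inter, Finset.card_univ]

theorem EmbeddedGraph.twistBracket_wiringDiagram (G : EmbeddedGraph V E)
    (color : E → EdgeColor) {A : K} (hd : loopValue A ≠ 0) (x : E → K) :
    (G.wiringDiagram color).twistBracket A x = loopValue A ^ Fintype.card E *
      ∑ S : Finset E, (∏ e ∈ S, twistEvaluation (loopValue A) x (.x (augment color e))) *
        (∏ e ∈ Finset.univ \ S, twistEvaluation (loopValue A) x (.y (augment color e))) *
        crossinglessBracket A (G.boundaryCount S) := by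
  rw [WiringDiagram.twistBracket, ← (connectingState color).sum_comp, Finset.mul_sum]
  refine Finset.sum_congr rfl fun S _ => ?_
  rw [prod_siteWeight_connectingState hd, G.stateCircles_connectingState, mul_assoc]

theorem theorem3_general [Finite V] [Nonempty V] (G : EmbeddedGraph V E) (hplane : G.IsPlane)
    (color : E → EdgeColor) (A : K) (hd : loopValue A ≠ 0) (x : E → K) :
    loopValue A ^ Fintype.card E *
        MvPolynomial.aeval (twistEvaluation (loopValue A) x)
          (wPolynomial (augment color) G.graph) =
      (G.wiringDiagram color).twistBracket A x := by
  have hW := aeval_wPolynomial_mul_pow (φ := twistEvaluation (loopValue A) x) hd rfl rfl rfl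
    (augment color) (H := G.graph) Set.univ_nonempty (F := Finset.univ) Finset.coe_univ
  have hcard : G.graph.vertexSet.ncard = Nat.card V := Set.ncard_univ V
  rw [hcard, Finset.powerset_univ] at hW
  rw [G.twistBracket_wiringDiagram color hd]
  congr 1
  refine mul_right_cancel₀ (pow_ne_zero (Nat.card V + 1) hd) ?_
  rw [hW, Finset.sum_mul]
  refine Finset.sum_congr rfl fun S _ => ?_
  rw [mul_assoc _ (crossinglessBracket A _),
    hplane.crossinglessBracket_boundaryCount_mul_pow hd]

end TwistBracket

theorem theorem3 {V E K : Type*} [Finite V] [Fintype E] [DecidableEq E] [Field K]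
    (G : EmbeddedGraph V E) (hplane : G.IsPlane) (hconn : G.graph.componentCount = 1)
    (color : E → EdgeColor) (A : K) (hA : A ≠ 0) (hd : loopValue A ≠ 0) (x : E → K) :
    loopValue A ^ Fintype.card E *
        MvPolynomial.aeval (twistEvaluation (loopValue A) x)
          (wPolynomial (augment color) G.graph) =
      (G.wiringDiagram color).twistBracket A x := by
  have : Nonempty V := (vertexSet_nonempty_of_componentCount_ne_zero
    (hconn.trans_ne one_ne_zero)).to_type
  exact theorem3_general G hplane color A hd x
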